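/- **Conventions.** Logarithms are in base 2, $\{0,1\}^*$ is the set of finite binary strings and $\ell(x)$ is the length of $x$. A *prefix computer* is a partial computable function $U(p,y)$ of a program $p\in\{0,1\}^*$ and an input $y$ (a string, a number, a pair, ..., given by a standard code) such that, for each fixed $y$, no program on which $U(\cdot,y)$ halts is a proper prefix of another such program; $U(p)$ means that the input is empty. It is *universal* if for every prefix computer $V$ there is a constant $c$ such that for every program $p$ there is a program $q$ with $\ell(q)\le\ell(p)+c$ and $U(q,y)=V(p,y)$ for all $y$ for which $V(p,y)$ is defined. Fix a universal prefix computer $U$. Put $K(x)=\min\{\ell(p): U(p)=x\}$ for a string $x$. For a real number $r\ge 0$, $K(r)$ is the length of the shortest program that, on every input $n\in\mathbb N$, outputs an approximation of $r$ of the form $m/2^n$ ($m\in\mathbb N$) with error at most $2^{-n}$ (and $K(r)=\infty$ if $r$ is not computable). An *ensemble* $\mathbb E$ is a computable probability distribution on $\{0,1\}^*$ whose entropy $H(\mathbb E)=-\sum_s\mathbb E(s)\log\mathbb E(s)$ is finite and computable. Its complexity $K(\mathbb E)$ is the length of the shortest program for $U$ that computes both $\mathbb E$ and $H(\mathbb E)$,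 that is, outputs approximations (as above) with error at most $2^{-n}$ of $\mathbb E(s)$ on request $(s,n)$, and of $H(\mathbb E)$ on request $n$. For $\delta,\Delta\ge 0$ and a set $\mathcal C$ of ensembles, the effective complexity of $x$ constrained to $\mathcal C$ is $$\mathcal E_{\delta,\Delta}(x|\mathcal C)=\inf\{K(\mathbb E): \mathbb E\in\mathcal C,\ \mathbb E(x)\ge 2^{-H(\mathbb E)(1+\delta)},\ K(\mathbb E)+H(\mathbb E)\le K(x)+\Delta\},$$ with $\inf\emptyset=\infty$, and $\mathcal E_{\delta,\Delta}(x)$ is the same quantity without the constraint $\mathbb E\in\mathcal C$. **Theorem (Effectively Complex Strings).** (i) For all real $\delta,\Delta\ge 0$ there is a function $f(n)=\mathcal O(\log\log n)$ (as $n\to\infty$, with constants that may depend on $\delta$ and $\Delta$) such that for every $n\in\mathbb N$ there is a string $x$ of length $n$ with $$\mathcal E_{\delta,\Delta}(x)\ \ge\ (1-\delta)\,n-(1+2\delta)\log n-f(n),$$ and with the same lower bound for $\mathcal E_{\delta,\Delta}(x|\mathcal C)$ for every set $\mathcal C$ of ensembles. (For $n=0$ the term $\log n$ is read as $0$.) (ii)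 There is a constant $\omega\in\mathbb N$, depending only on $U$, such that for all real $\delta,\Delta\ge 0$ with $K(\delta)<\infty$ and all $n\ge 2$ there is a string $x$ of length $n$ with $$\mathcal E_{\delta,\Delta}(x)\ \ge\ (1-\delta)\,n-(1+2\delta)\log n-2\log\log n-\Delta(4+\delta)-5K(\delta)-\omega,$$ and with the same lower bound for $\mathcal E_{\delta,\Delta}(x|\mathcal C)$ for every set $\mathcal C$ of ensembles. -/

import Mathlib

open scoped ENNReal

namespace EffectiveComplexity

noncomputable section

/-! ### Prefix computers

A computer takes a program `p` (a finite binary string) and an auxiliary input `y`, and it may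
output a datum.  Inputs and outputs are natural numbers; objects such as binary strings, pairs of
strings and numbers, etc. are passed through their standard effective codes `Encodable.encode`.
The input `0`, the code of the empty string, stands for "no input". -/

/-- Binary strings. -/
abbrev Str : Type := List Bool

/-- A prefix computer: a partial recursive function of program and input such that, for every
input `y`, no program halting on `y` is a proper prefix of another program halting on `y`. -/
structure IsPrefixComputer (U : Str → ℕ →. ℕ) : Prop where
  partrec : Partrec₂ U
  prefix_free : ∀ (y : ℕ) (p q : Str), (U p y).Dom → (U q y).Dom → p <+: q → p = q

/-- A universal prefix computer: a prefix computer `U` that simulates every prefix computer `V`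
with a constant overhead in program length, i.e. every program `p` of `V` has a counterpart `q`
for `U`, at most `c` bits longer, which on every input on which `p` halts gives the same
output. -/
structure IsUniversalPrefixComputer (U : Str → ℕ →. ℕ) : Prop extends IsPrefixComputer U where
  universal : ∀ V : Str → ℕ →. ℕ, IsPrefixComputer V →
    ∃ c : ℕ, ∀ p : Str, ∃ q : Str, q.length ≤ p.length + c ∧
      ∀ y z : ℕ, z ∈ V p y → z ∈ U q y

/-- The natural number `m`, read as the dyadic number `m / 2 ^ n`, approximates the real number
`r` with accuracy `2 ^ (-n)`. -/
def IsApprox (r : ℝ) (n m : ℕ) : Prop :=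
  |(m : ℝ) / 2 ^ n - r| ≤ 1 / 2 ^ n

/-- Prefix Kolmogorov complexity of a string: `K(x) = min {ℓ(p) | U(p) = x}`. -/
def K (U : Str → ℕ →. ℕ) (x : Str) : ℕ∞ :=
  ⨅ (p : Str) (_ : Encodable.encode x ∈ U p 0), (p.length : ℕ∞)

/-- Prefix Kolmogorov complexity of a (nonnegative) real number: the length of the shortest
program that, on input `n`, outputs an approximation of `r` with accuracy `2 ^ (-n)`; it is `⊤`
if there is no such program. -/
def KReal (U : Str → ℕ →. ℕ) (r : ℝ) : ℕ∞ :=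
  ⨅ (p : Str) (_ : ∀ n : ℕ, ∃ m ∈ U p n, IsApprox r n m), (p.length : ℕ∞)

/-! ### Ensembles -/

/-- The summand `- μ(s) log₂ μ(s)` of the entropy of a distribution on the binary strings. -/
def entropyTerm (μ : PMF Str) (s : Str) : ℝ :=
  -((μ s).toReal * Real.logb 2 (μ s).toReal)

/-- An ensemble: a computable probability distribution on the binary strings, with finite and
computable entropy. -/
structure Ensemble where
  dist : PMF Str
  computable_dist : ∃ f : Str → ℕ → ℕ, Computable₂ f ∧
    ∀ (s : Str) (n : ℕ), IsApprox (dist s).toReal n (f s n)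
  summable_entropy : Summable (entropyTerm dist)
  computable_entropy : ∃ f : ℕ → ℕ, Computable f ∧
    ∀ n : ℕ, IsApprox (∑' s, entropyTerm dist s) n (f n)

namespace Ensemble

/-- The probability `𝔼(s)` as a real number. -/
def prob (E : Ensemble) (s : Str) : ℝ := (E.dist s).toReal

/-- The entropy `H(𝔼) = - ∑ₛ 𝔼(s) log₂ 𝔼(s)`. -/
def H (E : Ensemble) : ℝ := ∑' s, entropyTerm E.dist s

/-- `p` is a program for the ensemble together with its entropy: asked for the string `s` and
the accuracy `n` it outputs an approximation of `𝔼(s)`, and asked for the entropy and the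
accuracy `n` it outputs an approximation of `H(𝔼)`. -/
def IsProgram (U : Str → ℕ →. ℕ) (E : Ensemble) (p : Str) : Prop :=
  (∀ (s : Str) (n : ℕ),
    ∃ m ∈ U p (Encodable.encode (Sum.inl (s, n) : (Str × ℕ) ⊕ ℕ)), IsApprox (E.prob s) n m) ∧
  (∀ n : ℕ,
    ∃ m ∈ U p (Encodable.encode (Sum.inr n : (Str × ℕ) ⊕ ℕ)), IsApprox E.H n m)

/-- The complexity `K(𝔼) = K(𝔼, H(𝔼))` of an ensemble. -/
def K (U : Str → ℕ →. ℕ) (E : Ensemble) : ℕ∞ :=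
  ⨅ (p : Str) (_ : E.IsProgram U p), (p.length : ℕ∞)

/-- The total information `Σ(𝔼) = K(𝔼) + H(𝔼)`. -/
def totalInfo (U : Str → ℕ →. ℕ) (E : Ensemble) : EReal :=
  ((E.K U : ℝ≥0∞) : EReal) + (E.H : EReal)

/-- The string `x` is `δ`-typical for the ensemble: `𝔼(x) ≥ 2 ^ (-H(𝔼)(1+δ))`. -/
def IsTypical (δ : ℝ) (E : Ensemble) (x : Str) : Prop :=
  (2 : ℝ) ^ (-(E.H * (1 + δ))) ≤ E.prob x

end Ensemble

/-! ### Effective complexity -/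

/-- The minimization domain: the ensembles for which `x` is `δ`-typical and whose total
information is at most `K(x) + Δ`. -/
def minDomain (U : Str → ℕ →. ℕ) (δ Δ : ℝ) (x : Str) : Set Ensemble :=
  {E | E.IsTypical δ x ∧ E.totalInfo U ≤ ((K U x : ℝ≥0∞) : EReal) + (Δ : EReal)}

/-- The effective complexity of `x`; it is `⊤` if the minimization domain is empty. -/
def effComplexity (U : Str → ℕ →. ℕ) (δ Δ : ℝ) (x : Str) : ℕ∞ :=
  ⨅ E ∈ minDomain U δ Δ x, E.K U

/-- The effective complexity of `x` constrained to the set `C` of ensembles; it is `⊤` if the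
constrained minimization domain is empty. -/
def effComplexityOn (U : Str → ℕ →. ℕ) (δ Δ : ℝ) (x : Str) (C : Set Ensemble) : ℕ∞ :=
  ⨅ E ∈ minDomain U δ Δ x ∩ C, E.K U

/-- The real number `b` is a lower bound for the effective complexity
of `x` and for its effective complexity constrained to any set of ensembles. -/
def IsLowerBound (U : Str → ℕ →. ℕ) (δ Δ : ℝ) (x : Str) (b : ℝ) : Prop :=
  (b : EReal) ≤ ((effComplexity U δ Δ x : ℝ≥0∞) : EReal) ∧
  ∀ C : Set Ensemble, (b : EReal) ≤ ((effComplexityOn U δ Δ x C : ℝ≥0∞) : EReal)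

end

end EffectiveComplexity

namespace EffectiveComplexity

/-! This is a busy-beaver argument. Fix `n`, let `b` be the claimed bound, and among the programs
shorter than `b` that answer all probability requests for strings of length `n` let `p` be one that
finishes last. From `n` and `p` one can reach a stage at which `p`, hence every ensemble program
shorter than `b`, has answered, and then compute a string `x` to which no finished program shorter
than `n` gives much probability. Such an `x` exists (`exists_not_excluded`): the answers of a
program `q` can favour at most `2 ^ (n - 1 - ℓ(q))` strings, and by Kraft's inequality at least half
of all strings remain.

The description of `x` costs `ℓ(p) + log n + 2 log log n + O(1)`, which stays below `(1 - δ) n`. An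
ensemble in the minimization domain with `K(𝔼) < b` therefore has so little entropy that typicality
forces `𝔼(x) ≥ 2 ^ (3 + K(𝔼) - n)` (`prob_ge_of_mem_minDomain`), and its shortest program would have
excluded `x` (`excluded_of_prob_ge`). The parameter `δ` enters only this comparison of real numbers
and is never given to the computer, so the bound holds even without the term `5 K(δ)`. -/

/-! ### Kraft's inequality -/

theorem uniquelyDecodable_of_prefix_free {α : Type*} {S : Set (List α)} (hnil : [] ∉ S)
    (h : ∀ p ∈ S, ∀ q ∈ S, p <+: q → p = q) : InformationTheory.UniquelyDecodable S := by
  intro L₁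
  induction L₁ with
  | nil =>
    intro L₂ _ h₂ he
    cases L₂ with
    | nil => rfl
    | cons a L =>
      simp only [List.flatten_nil, List.flatten_cons] at he
      have : a = [] := (List.append_eq_nil_iff.1 he.symm).1
      exact absurd (this ▸ h₂ a (by simp)) hnil
  | cons a L ih =>
    intro L₂ h₁ h₂ he
    cases L₂ with
    | nil =>
      simp only [List.flatten_nil, List.flatten_cons] at he
      have : a = [] := (List.append_eq_nil_iff.1 he).1
      exact absurd (this ▸ h₁ a (by simp)) hnil
    | cons a' L' =>
      simp only [List.flatten_cons] at he
      have hab : a = a' := by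
        rcases List.prefix_or_prefix_of_prefix (List.prefix_append a L.flatten)
          (he ▸ List.prefix_append a' L'.flatten) with hp | hp
        · exact h _ (h₁ a (by simp)) _ (h₂ a' (by simp)) hp
        · exact (h _ (h₂ a' (by simp)) _ (h₁ a (by simp)) hp).symm
      subst hab
      rw [ih L' (fun w hw => h₁ w (by simp [hw])) (fun w hw => h₂ w (by simp [hw]))
        (List.append_cancel_left he)]

/-- Kraft's inequality for finite prefix-free sets of binary strings. -/
theorem kraft_of_prefix_free (S : Finset Str) (h : ∀ p ∈ S, ∀ q ∈ S, p <+: q → p = q) :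
    ∑ q ∈ S, (1 / 2 : ℝ) ^ q.length ≤ 1 := by
  -- The empty word is a prefix of everything, so it can only occur alone; it is never part of a
  -- uniquely decodable code.
  by_cases hnil : [] ∈ S
  · have : S = {[]} := by
      ext q
      refine ⟨fun hq => ?_, fun hq => by simp_all⟩
      simp [← h [] hnil q hq (List.nil_prefix)]
    simp [this]
  · have := InformationTheory.kraft_mcmillan_inequality (S := S)
      (uniquelyDecodable_of_prefix_free (by simpa using hnil) (by simpa using h))
    simpa using this

/-! ### Excluding probable strings -/

/-- The binary strings of length `n`. -/
def strs (n : ℕ) : List Str :=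
  Nat.rec [[]] (fun _ L => L.flatMap fun s => [false :: s, true :: s]) n

theorem strs_succ (n : ℕ) : strs (n + 1) = (strs n).flatMap fun s => [false :: s, true :: s] := rfl

theorem mem_strs {n : ℕ} {s : Str} : s ∈ strs n ↔ s.length = n := by
  induction n generalizing s with
  | zero => simp [strs]
  | succ n ih =>
    rw [strs_succ, List.mem_flatMap]
    constructor
    · rintro ⟨r, hr, h⟩
      rw [ih] at hr
      simp only [List.mem_cons, List.not_mem_nil, or_false] at h
      rcases h with rfl | rfl <;> simp [hr]
    · intro h
      cases s with
      | nil => simp at h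
      | cons b r => exact ⟨r, ih.2 (by simpa using h), by cases b <;> simp⟩

theorem length_strs (n : ℕ) : (strs n).length = 2 ^ n := by
  induction n with
  | zero => simp [strs]
  | succ n ih => rw [strs_succ, List.length_flatMap]; simp [ih, pow_succ]

theorem nodup_strs (n : ℕ) : (strs n).Nodup := by
  induction n with
  | zero => simp [strs]
  | succ n ih =>
    rw [strs_succ, List.nodup_flatMap]
    refine ⟨fun s _ => by simp, ih.imp fun hab => ?_⟩
    simp [Function.onFun, Ne.symm hab]

/-- The request for the probability of `y` with accuracy `2 ^ (-n)`. -/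
def query (n : ℕ) (y : Str) : ℕ := Encodable.encode (Sum.inl (y, n) : (Str × ℕ) ⊕ ℕ)

/-- At stage `t` of the simulation `g`, the program `q` has answered all requests for strings of
length `n`, and the answers add up to at most twice the total mass. -/
def Answers (g : ℕ → Str → ℕ → Option ℕ) (t : ℕ) (q : Str) (n : ℕ) : Prop :=
  (∀ y ∈ strs n, (g t q (query n y)).isSome) ∧
    ((strs n).map fun y => (g t q (query n y)).getD 0).sum ≤ 2 ^ (n + 1)

/-- At stage `t`, some program has given `x` a probability that is large compared with
the length of the program. -/
def Excluded (g : ℕ → Str → ℕ → Option ℕ) (t n : ℕ) (x : Str) : Prop :=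
  ∃ q ∈ (List.range n).flatMap strs, Answers g t q n ∧
    2 ^ (2 + q.length) ≤ (g t q (query n x)).getD 0

variable {g : ℕ → Str → ℕ → Option ℕ}

theorem Answers.mono (hg : ∀ {t t' q y z}, t ≤ t' → g t q y = some z → g t' q y = some z)
    {t t' n : ℕ} {q : Str} (ht : t ≤ t') (h : Answers g t q n) : Answers g t' q n := by
  have key : ∀ y ∈ strs n, g t' q (query n y) = g t q (query n y) := by
    intro y hy
    obtain ⟨z, hz⟩ := Option.isSome_iff_exists.1 (h.1 y hy)
    rw [hz, hg ht hz]
  refine ⟨fun y hy => by rw [key y hy]; exact h.1 y hy, ?_⟩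
  rw [List.map_congr_left (fun y hy => by rw [key y hy])]
  exact h.2

/-- Markov's inequality for each program, then Kraft's inequality over the programs. -/
theorem exists_not_excluded (t n : ℕ)
    (hp : ∀ y p q, (g t p y).isSome → (g t q y).isSome → p <+: q → p = q) :
    ∃ x ∈ strs n, ¬ Excluded g t n x := by
  classical
  by_contra! hall
  set S := (strs n).toFinset with hS
  set Q := ((List.range n).flatMap strs).toFinset.filter (fun q => Answers g t q n) with hQ
  set m : Str → Str → ℕ := fun q x => (g t q (query n x)).getD 0 with hm
  have hcard : S.card = 2 ^ n := by
    rw [hS, List.toFinset_card_of_nodup (nodup_strs n), length_strs]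
  have hsub : S ⊆ Q.biUnion fun q => S.filter fun x => 2 ^ (2 + q.length) ≤ m q x := by
    intro x hx
    obtain ⟨q, hq, ha, hle⟩ := hall x (by simpa [hS] using hx)
    simp only [Finset.mem_biUnion, Finset.mem_filter, hQ, List.mem_toFinset]
    exact ⟨q, ⟨hq, ha⟩, hx, hle⟩
  have hone : ∀ q ∈ Q, ((S.filter fun x => 2 ^ (2 + q.length) ≤ m q x).card : ℝ)
      ≤ 2 ^ n / 2 * (1 / 2) ^ q.length := by
    intro q hq
    have ha : Answers g t q n := (Finset.mem_filter.1 hq).2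
    have h1 : (S.filter fun x => 2 ^ (2 + q.length) ≤ m q x).card * 2 ^ (2 + q.length)
        ≤ 2 ^ (n + 1) := by
      calc _ ≤ ∑ x ∈ S.filter (fun x => 2 ^ (2 + q.length) ≤ m q x), m q x := by
            rw [← smul_eq_mul]
            exact Finset.card_nsmul_le_sum _ _ _ fun x hx => (Finset.mem_filter.1 hx).2
        _ ≤ ∑ x ∈ S, m q x := Finset.sum_le_sum_of_subset (Finset.filter_subset _ _)
        _ = ((strs n).map (m q)).sum := List.sum_toFinset _ (nodup_strs n)
        _ ≤ _ := ha.2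
    have h2 : ((S.filter fun x => 2 ^ (2 + q.length) ≤ m q x).card : ℝ) * 2 ^ (2 + q.length)
        ≤ 2 ^ (n + 1) := by exact_mod_cast h1
    rw [one_div, inv_pow, ← div_eq_mul_inv, le_div_iff₀ (by positivity)]
    rw [pow_add (2 : ℝ), pow_succ (2 : ℝ) n] at h2
    linarith
  have hkraft : ∑ q ∈ Q, (1 / 2 : ℝ) ^ q.length ≤ 1 := by
    refine kraft_of_prefix_free Q fun p hpQ q hqQ => ?_
    -- Prefix-freeness holds for each input separately; any one string of length `n` gives a request
    -- that all programs in `Q` answer.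
    have h0 : List.replicate n false ∈ strs n := mem_strs.2 (by simp)
    exact hp _ p q ((Finset.mem_filter.1 hpQ).2.1 _ h0) ((Finset.mem_filter.1 hqQ).2.1 _ h0)
  have hfin : (2 : ℝ) ^ n ≤ 2 ^ n / 2 := by
    calc (2 : ℝ) ^ n = (S.card : ℝ) := by rw [hcard]; norm_cast
      _ ≤ ((∑ q ∈ Q, (S.filter fun x => 2 ^ (2 + q.length) ≤ m q x).card : ℕ) : ℝ) := by
        exact_mod_cast (Finset.card_le_card hsub).trans Finset.card_biUnion_le
      _ ≤ ∑ q ∈ Q, 2 ^ n / 2 * (1 / 2 : ℝ) ^ q.length := by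
        push_cast; exact Finset.sum_le_sum hone
      _ ≤ 2 ^ n / 2 := by
        rw [← Finset.mul_sum]
        exact mul_le_of_le_one_right (by positivity) hkraft
  have : (0 : ℝ) < 2 ^ n := by positivity
  linarith

/-! ### Self-delimiting descriptions -/

/-- The number with the given binary digits, least significant digit first. -/
def ofDigits (l : List Bool) : ℕ := l.foldr (fun b k => 2 * k + b.toNat) 0

theorem ofDigits_bits (n : ℕ) : ofDigits n.bits = n := by
  induction n using Nat.binaryRec' with
  | zero => simp [ofDigits]
  | bit b n h ih =>
    rw [Nat.bits_append_bit n b h]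
    simp only [ofDigits, List.foldr_cons] at ih ⊢
    rw [ih, Nat.bit_val]

/-- A self-delimiting description of the number with digits `b`, followed by `p`; the string `a`
holds the digits of the length of `b`. -/
def frame (a b p : Str) : Str := a.map (fun _ => true) ++ false :: (a ++ (b ++ p))

theorem length_frame (a b p : Str) :
    (frame a b p).length = 2 * a.length + 1 + b.length + p.length := by
  simp [frame]; ring

theorem replicate_true_append_false_inj {j k : ℕ} {l l' r : Str}
    (h : List.replicate j true ++ false :: l ++ r = List.replicate k true ++ false :: l') :
    j = k ∧ l ++ r = l' := by
  induction j generalizing k with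
  | zero => cases k <;> simp_all [List.replicate_succ]
  | succ j ih =>
    cases k with
    | zero => simp [List.replicate_succ] at h
    | succ k =>
      have := ih (k := k) (by simpa [List.replicate_succ] using h)
      exact ⟨by rw [this.1], this.2⟩

/-- The unary header fixes the length of `a`, and `a` fixes the length of `b`, so the comparison
proceeds block by block. -/
theorem frame_prefix {a b p a' b' p' : Str} (hb : ofDigits a = b.length)
    (hb' : ofDigits a' = b'.length) (h : frame a b p <+: frame a' b' p') :
    a = a' ∧ b = b' ∧ p <+: p' := by
  obtain ⟨r, hr⟩ := h
  simp only [frame, List.map_const'] at hr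
  obtain ⟨h1, h2⟩ := replicate_true_append_false_inj hr
  rw [List.append_assoc] at h2
  obtain ⟨rfl, h3⟩ := List.append_inj h2 h1
  rw [List.append_assoc] at h3
  obtain ⟨rfl, h4⟩ := List.append_inj h3 (hb.symm.trans hb')
  exact ⟨rfl, rfl, r, h4⟩

/-! ### Primitive recursiveness of exclusion -/

theorem primrec_strs : Primrec strs := by
  refine Primrec.nat_rec₁ (f := fun _ L => L.flatMap fun s => [false :: s, true :: s]) [[]] ?_
  refine Primrec.list_flatMap Primrec.snd ?_
  exact Primrec.list_cons.comp (Primrec.list_cons.comp (Primrec.const false) Primrec.snd)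
    (Primrec.list_cons.comp (Primrec.list_cons.comp (Primrec.const true) Primrec.snd)
      (Primrec.const []))

theorem primrec_ofDigits : Primrec ofDigits := by
  have h : Primrec₂ fun (_ : Str) (v : Bool × ℕ) => 2 * v.2 + v.1.toNat :=
    Primrec.nat_add.comp (Primrec.nat_mul.comp (Primrec.const 2) (Primrec.snd.comp Primrec.snd))
      ((Primrec.dom_finite Bool.toNat).comp (Primrec.fst.comp Primrec.snd))
  exact Primrec.list_foldr Primrec.id (Primrec.const 0) h

theorem primrec_frame : Primrec fun w : Str × Str × Str => frame w.1 w.2.1 w.2.2 := by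
  refine Primrec.list_append.comp (Primrec.list_map Primrec.fst (Primrec.const true).to₂) ?_
  refine Primrec.list_cons.comp (Primrec.const false) ?_
  exact Primrec.list_append.comp Primrec.fst
    (Primrec.list_append.comp (Primrec.fst.comp Primrec.snd) (Primrec.snd.comp Primrec.snd))

theorem primrec_two_pow : Primrec fun n : ℕ => 2 ^ n := by
  refine (Primrec.nat_rec₁ (f := fun _ k => 2 * k) 1
    (Primrec.nat_mul.comp (Primrec.const 2) Primrec.snd)).of_eq fun n => ?_
  induction n with
  | zero => rfl
  | succ n ih => simp only [] at ih ⊢; rw [ih, pow_succ, mul_comm]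

theorem primrec_query : Primrec₂ query :=
  Primrec.encode.comp (Primrec.sumInl.comp (Primrec.snd.pair Primrec.fst))

theorem primrec_list_sum : Primrec (List.sum : List ℕ → ℕ) :=
  Primrec.list_foldr Primrec.id (Primrec.const 0)
    (Primrec.nat_add.comp (Primrec.fst.comp Primrec.snd) (Primrec.snd.comp Primrec.snd)).to₂

theorem primrecPred_answers (hg : Primrec fun w : ℕ × Str × ℕ => g w.1 w.2.1 w.2.2) :
    PrimrecPred fun w : ℕ × Str × ℕ => Answers g w.1 w.2.1 w.2.2 := by
  have hval : Primrec₂ fun (w : ℕ × Str × ℕ) (y : Str) => g w.1 w.2.1 (query w.2.2 y) :=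
    hg.comp ((Primrec.fst.comp Primrec.fst).pair
      ((Primrec.fst.comp (Primrec.snd.comp Primrec.fst)).pair
        (primrec_query.comp (Primrec.snd.comp (Primrec.snd.comp Primrec.fst)) Primrec.snd)))
  have hstrs : Primrec fun w : ℕ × Str × ℕ => strs w.2.2 :=
    primrec_strs.comp (Primrec.snd.comp Primrec.snd)
  refine PrimrecPred.and ?_ ?_
  · have hrel : PrimrecRel fun (y : Str) (w : ℕ × Str × ℕ) =>
        (g w.1 w.2.1 (query w.2.2 y)).isSome = true :=
      Primrec.eq.comp (Primrec.option_isSome.comp (hval.comp Primrec.snd Primrec.fst))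
        (Primrec.const true)
    exact (PrimrecRel.forall_mem_list hrel).comp hstrs Primrec.id
  · exact Primrec.nat_le.comp
      (primrec_list_sum.comp (Primrec.list_map hstrs
        (Primrec.option_getD.comp hval (Primrec.const 0)).to₂))
      (primrec_two_pow.comp (Primrec.succ.comp (Primrec.snd.comp Primrec.snd)))

theorem primrecPred_excluded (hg : Primrec fun w : ℕ × Str × ℕ => g w.1 w.2.1 w.2.2) :
    PrimrecPred fun w : ℕ × ℕ × Str => Excluded g w.1 w.2.1 w.2.2 := by
  have hrel : PrimrecRel fun (q : Str) (w : ℕ × ℕ × Str) =>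
      Answers g w.1 q w.2.1 ∧ 2 ^ (2 + q.length) ≤ (g w.1 q (query w.2.1 w.2.2)).getD 0 := by
    have ht : Primrec fun v : Str × ℕ × ℕ × Str => v.2.1 := Primrec.fst.comp Primrec.snd
    have hn : Primrec fun v : Str × ℕ × ℕ × Str => v.2.2.1 :=
      Primrec.fst.comp (Primrec.snd.comp Primrec.snd)
    have hx : Primrec fun v : Str × ℕ × ℕ × Str => v.2.2.2 :=
      Primrec.snd.comp (Primrec.snd.comp Primrec.snd)
    refine PrimrecPred.and ?_ ?_
    · exact (primrecPred_answers hg).comp (ht.pair (Primrec.fst.pair hn))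
    · exact Primrec.nat_le.comp
        (primrec_two_pow.comp (Primrec.nat_add.comp (Primrec.const 2)
          (Primrec.list_length.comp Primrec.fst)))
        (Primrec.option_getD.comp
          (hg.comp (ht.pair (Primrec.fst.pair (primrec_query.comp hn hx)))) (Primrec.const 0))
  exact (PrimrecRel.exists_mem_list hrel).comp
    (Primrec.list_flatMap (Primrec.list_range.comp (Primrec.fst.comp Primrec.snd))
      (primrec_strs.comp Primrec.snd).to₂) Primrec.id

/-! ### The computer that outputs a string not excluded -/

/-- The tuple `(a, b, p, t, x)` explains the program `s`: the number `n` with digits `b` and the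
program `p` are framed in `s`, and `p` has answered all requests for strings of length `n` at
stage `t`, at which the string `x` of length `n` is not excluded. -/
def Explains (g : ℕ → Str → ℕ → Option ℕ) (s : Str) (w : Str × Str × Str × ℕ × Str) : Prop :=
  s = frame w.1 w.2.1 w.2.2.1 ∧ ofDigits w.1 = w.2.1.length ∧
    Answers g w.2.2.2.1 w.2.2.1 (ofDigits w.2.1) ∧ w.2.2.2.2.length = ofDigits w.2.1 ∧
      ¬ Excluded g w.2.2.2.1 (ofDigits w.2.1) w.2.2.2.2

theorem primrecRel_explains (hg : Primrec fun w : ℕ × Str × ℕ => g w.1 w.2.1 w.2.2) :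
    PrimrecRel (Explains g) := by
  let T := Str × (Str × Str × Str × ℕ × Str)
  have ha : Primrec fun v : T => v.2.1 := Primrec.fst.comp Primrec.snd
  have h2 : Primrec fun v : T => v.2.2 := Primrec.snd.comp Primrec.snd
  have hb : Primrec fun v : T => v.2.2.1 := Primrec.fst.comp h2
  have h3 : Primrec fun v : T => v.2.2.2 := Primrec.snd.comp h2
  have hp : Primrec fun v : T => v.2.2.2.1 := Primrec.fst.comp h3
  have h4 : Primrec fun v : T => v.2.2.2.2 := Primrec.snd.comp h3
  have ht : Primrec fun v : T => v.2.2.2.2.1 := Primrec.fst.comp h4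
  have hx : Primrec fun v : T => v.2.2.2.2.2 := Primrec.snd.comp h4
  have hn : Primrec fun v : T => ofDigits v.2.2.1 := primrec_ofDigits.comp hb
  refine PrimrecPred.and ?_ (PrimrecPred.and ?_ (PrimrecPred.and ?_ (PrimrecPred.and ?_ ?_)))
  · exact Primrec.eq.comp Primrec.fst (primrec_frame.comp (ha.pair (hb.pair hp)))
  · exact Primrec.eq.comp (primrec_ofDigits.comp ha) (Primrec.list_length.comp hb)
  · exact (primrecPred_answers hg).comp (ht.pair (hp.pair hn))
  · exact Primrec.eq.comp (Primrec.list_length.comp hx) hn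
  · exact PrimrecPred.not ((primrecPred_excluded hg).comp (ht.pair (hn.pair hx)))

open Classical in
/-- One step of the search for a tuple that explains `s`. -/
noncomputable def searchStep (g : ℕ → Str → ℕ → Option ℕ) (s : Str) (i : ℕ) : Option ℕ :=
  (Encodable.decode (α := Str × Str × Str × ℕ × Str) i).bind fun w =>
    if Explains g s w then some (Encodable.encode w.2.2.2.2) else none

theorem primrec_searchStep (hg : Primrec fun w : ℕ × Str × ℕ => g w.1 w.2.1 w.2.2) :
    Primrec₂ (searchStep g) := by
  classical
  refine Primrec.option_bind (Primrec.decode.comp Primrec.snd) ?_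
  refine Primrec.ite ((primrecRel_explains hg).comp (Primrec.fst.comp Primrec.fst) Primrec.snd) ?_
    (Primrec.const none)
  exact Primrec.option_some.comp (Primrec.encode.comp (Primrec.snd.comp (Primrec.snd.comp
    (Primrec.snd.comp (Primrec.snd.comp Primrec.snd)))))

theorem mem_searchStep {s : Str} {i z : ℕ} (h : z ∈ searchStep g s i) :
    ∃ w, Explains g s w ∧ z = Encodable.encode w.2.2.2.2 := by
  simp only [searchStep, Option.mem_def, Option.bind_eq_some_iff] at h
  obtain ⟨w, _, hw⟩ := h
  split_ifs at hw with he
  exact ⟨w, he, (Option.some.inj hw).symm⟩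

/-- The computer that outputs a string that is not excluded when the framed program halts. -/
noncomputable def avoider (g : ℕ → Str → ℕ → Option ℕ) (s : Str) (_ : ℕ) : Part ℕ :=
  Nat.rfindOpt (searchStep g s)

/-- Nested halting programs share the framed number, and their inner programs answer a common
request, possibly at different stages, so these coincide as well. -/
theorem isPrefixComputer_avoider (hg : Primrec fun w : ℕ × Str × ℕ => g w.1 w.2.1 w.2.2)
    (hp : ∀ t t' y p q, (g t p y).isSome → (g t' q y).isSome → p <+: q → p = q) :
    IsPrefixComputer (avoider g) where
  partrec := Partrec.rfindOpt ((primrec_searchStep hg).comp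
    (Primrec.fst.comp Primrec.fst) Primrec.snd).to₂.to_comp
  prefix_free := by
    intro _ s s' hs hs' hss
    obtain ⟨i, z, hz⟩ := Nat.rfindOpt_dom.1 hs
    obtain ⟨i', z', hz'⟩ := Nat.rfindOpt_dom.1 hs'
    obtain ⟨⟨a, b, p, t, x⟩, ⟨rfl, hb, ha, -⟩, -⟩ := mem_searchStep hz
    obtain ⟨⟨a', b', p', t', x'⟩, ⟨rfl, hb', ha', -⟩, -⟩ := mem_searchStep hz'
    dsimp only at *
    obtain ⟨rfl, rfl, hpp⟩ := frame_prefix hb hb' hss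
    have h0 : List.replicate (ofDigits b) false ∈ strs (ofDigits b) := mem_strs.2 (by simp)
    rw [hp t t' _ p p' (ha.1 _ h0) (ha'.1 _ h0) hpp]

/-- The framed program yields a string which is not excluded at some stage at which the program
has answered. -/
theorem exists_mem_avoider (hp : ∀ t t' y p q, (g t p y).isSome → (g t' q y).isSome →
      p <+: q → p = q) {t n : ℕ} {p : Str} (h : Answers g t p n) (y : ℕ) :
    ∃ t' x, Answers g t' p n ∧ x.length = n ∧ ¬ Excluded g t' n x ∧
      Encodable.encode x ∈ avoider g (frame n.bits.length.bits n.bits p) y := by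
  obtain ⟨x, hx, hne⟩ := exists_not_excluded (g := g) t n (hp t t)
  have hdom : (avoider g (frame n.bits.length.bits n.bits p) y).Dom := by
    refine Nat.rfindOpt_dom.2 ⟨Encodable.encode (n.bits.length.bits, n.bits, p, t, x),
      Encodable.encode x, ?_⟩
    simp only [searchStep, Encodable.encodek, Option.bind_some]
    rw [if_pos]
    · rfl
    · exact ⟨rfl, ofDigits_bits _, by simpa [ofDigits_bits] using h,
          by simpa [ofDigits_bits] using mem_strs.1 hx, by simpa [ofDigits_bits] using hne⟩
  obtain ⟨z, hz⟩ := Part.dom_iff_mem.1 hdom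
  obtain ⟨i, hi⟩ := Nat.rfindOpt_spec hz
  obtain ⟨⟨a, b, p', t', x'⟩, ⟨hf, hb, ha, hlen, hex⟩, rfl⟩ := mem_searchStep hi
  dsimp only at *
  -- The search may find another tuple than the one exhibited: number and program must agree, but
  -- stage and string may differ.
  obtain ⟨rfl, rfl, hpp⟩ := frame_prefix (ofDigits_bits n.bits.length) hb (by rw [hf])
  rw [ofDigits_bits] at ha hlen hex
  have h0 : List.replicate n false ∈ strs n := mem_strs.2 (by simp)
  obtain rfl := hp t t' _ p p' (h.1 _ h0) (ha.1 _ h0) hpp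
  exact ⟨t', x', ha, hlen, hex, hz⟩

/-! ### Stages of a computation and complexities as infima -/

theorem IsPrefixComputer.exists_stages {U : Str → ℕ →. ℕ} (hU : IsPrefixComputer U) :
    ∃ g : ℕ → Str → ℕ → Option ℕ, (Primrec fun w : ℕ × Str × ℕ => g w.1 w.2.1 w.2.2) ∧
      (∀ {t t' q y z}, t ≤ t' → g t q y = some z → g t' q y = some z) ∧
      (∀ p y z, z ∈ U p y ↔ ∃ t, g t p y = some z) := by
  obtain ⟨c, hc⟩ := Nat.Partrec.Code.exists_code.1 hU.partrec
  refine ⟨fun t p y => c.evaln t (Encodable.encode (p, y)), ?_, ?_, ?_⟩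
  · exact Nat.Partrec.Code.primrec_evaln.comp
      ((Primrec.fst.pair (Primrec.const c)).pair (Primrec.encode.comp Primrec.snd))
  · intro t t' q y z ht h
    exact Nat.Partrec.Code.evaln_mono ht h
  · intro p y z
    have : z ∈ U p y ↔ z ∈ c.eval (Encodable.encode (p, y)) := by
      rw [hc]; simp
    rw [this, Nat.Partrec.Code.evaln_complete]; rfl

theorem exists_length_eq_of_iInf_eq {P : Str → Prop} {k : ℕ}
    (h : ⨅ (p : Str) (_ : P p), (p.length : ℕ∞) = k) : ∃ p, P p ∧ p.length = k := by
  by_contra! hne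
  have hle : ((k + 1 : ℕ) : ℕ∞) ≤ ⨅ (p : Str) (_ : P p), (p.length : ℕ∞) := by
    refine le_iInf₂ fun p hp => ?_
    have h1 : (k : ℕ∞) ≤ p.length := h ▸ iInf₂_le p hp
    have h2 := hne p hp
    norm_cast at h1 ⊢
    omega
  rw [h] at hle
  norm_cast at hle
  omega

theorem coe_ennreal_natCast (n : ℕ) : ((n : ℝ≥0∞) : EReal) = ((n : ℝ) : EReal) := by
  rw [← ENNReal.ofReal_natCast, EReal.coe_ennreal_ofReal, max_eq_left n.cast_nonneg]

theorem isLowerBound_of_forall {U : Str → ℕ →. ℕ} {δ Δ b : ℝ} {x : Str}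
    (h : ∀ E ∈ minDomain U δ Δ x, ∀ k : ℕ, E.K U = k → b ≤ k) : IsLowerBound U δ Δ x b := by
  -- Complexities are natural numbers or `⊤`, so `b` can be rounded up and the infima compared in
  -- `ℕ∞`.
  have hE : ∀ E ∈ minDomain U δ Δ x, ((⌈b⌉₊ : ℕ) : ℕ∞) ≤ E.K U := by
    intro E hE
    cases hk : E.K U with
    | top => exact le_top
    | coe k => exact_mod_cast Nat.ceil_le.2 (h E hE k hk)
  have key : ∀ v : ℕ∞, ((⌈b⌉₊ : ℕ) : ℕ∞) ≤ v → (b : EReal) ≤ ((v : ℝ≥0∞) : EReal) := by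
    intro v hv
    have h1 : (b : EReal) ≤ ((⌈b⌉₊ : ℝ) : EReal) := EReal.coe_le_coe (Nat.le_ceil b)
    have h2 : (((⌈b⌉₊ : ℕ∞) : ℝ≥0∞) : EReal) ≤ ((v : ℝ≥0∞) : EReal) :=
      EReal.coe_ennreal_le_coe_ennreal_iff.2 (ENat.toENNReal_mono hv)
    refine h1.trans (le_trans (le_of_eq ?_) h2)
    rw [ENat.toENNReal_coe, coe_ennreal_natCast]
  exact ⟨key _ (le_iInf₂ hE), fun C => key _ (le_iInf₂ fun E h => hE E h.1)⟩

/-! ### Programs of ensembles -/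

theorem Ensemble.sum_prob_le_one (E : Ensemble) (S : Finset Str) : ∑ s ∈ S, E.prob s ≤ 1 := by
  have h : ∑ s ∈ S, E.dist s ≤ 1 := E.dist.tsum_coe ▸ ENNReal.sum_le_tsum S
  have h2 := ENNReal.toReal_mono ENNReal.one_ne_top h
  rwa [ENNReal.toReal_sum fun s _ => E.dist.apply_ne_top s, ENNReal.toReal_one] at h2

theorem IsApprox.le {r : ℝ} {n m : ℕ} (h : IsApprox r n m) : (m : ℝ) ≤ 2 ^ n * r + 1 := by
  have h1 := (abs_le.1 h).2
  rw [sub_le_iff_le_add, div_le_iff₀ (by positivity)] at h1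
  have : (1 / 2 ^ n + r) * 2 ^ n = 2 ^ n * r + 1 := by field_simp; ring
  linarith

theorem IsApprox.ge {r : ℝ} {n m : ℕ} (h : IsApprox r n m) : 2 ^ n * r - 1 ≤ (m : ℝ) := by
  have h1 := (abs_le.1 h).1
  have h2 : r - 1 / 2 ^ n ≤ (m : ℝ) / 2 ^ n := by linarith
  rw [le_div_iff₀ (by positivity)] at h2
  have : (r - 1 / 2 ^ n) * 2 ^ n = 2 ^ n * r - 1 := by field_simp
  linarith

variable {U : Str → ℕ →. ℕ}

/-- Scaled by `2 ^ n` the probabilities add up to at most `2 ^ n`, and rounding adds at most `1` for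
each of the `2 ^ n` strings. -/
theorem exists_answers (hmono : ∀ {t t' q y z}, t ≤ t' → g t q y = some z → g t' q y = some z)
    (hg : ∀ p y z, z ∈ U p y ↔ ∃ t, g t p y = some z) {E : Ensemble} {p : Str}
    (hp : E.IsProgram U p) (n : ℕ) : ∃ t, Answers g t p n := by
  choose m hm happ using fun y => hp.1 y n
  choose τ hτ using fun y => (hg p _ _).1 (hm y)
  have key : ∀ y ∈ strs n, g ((strs n).toFinset.sup τ) p (query n y) = some (m y) := fun y hy =>
    hmono (Finset.le_sup (f := τ) (List.mem_toFinset.2 hy)) (hτ y)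
  refine ⟨(strs n).toFinset.sup τ, fun y hy => by rw [key y hy]; rfl, ?_⟩
  rw [List.map_congr_left (g := m) (fun y hy => by rw [key y hy]; rfl),
    ← List.sum_toFinset _ (nodup_strs n)]
  have h : ((∑ y ∈ (strs n).toFinset, m y : ℕ) : ℝ) ≤ 2 ^ (n + 1) := by
    push_cast
    calc ∑ y ∈ (strs n).toFinset, (m y : ℝ)
        ≤ ∑ y ∈ (strs n).toFinset, (2 ^ n * E.prob y + 1) :=
          Finset.sum_le_sum fun y _ => (happ y).le
      _ = 2 ^ n * ∑ y ∈ (strs n).toFinset, E.prob y + 2 ^ n := by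
          rw [Finset.sum_add_distrib, ← Finset.mul_sum, Finset.sum_const,
            List.toFinset_card_of_nodup (nodup_strs n), length_strs]
          simp
      _ ≤ 2 ^ n * 1 + 2 ^ n := by gcongr; exact E.sum_prob_le_one _
      _ = 2 ^ (n + 1) := by ring
  exact_mod_cast h

/-- A program of an ensemble excludes the strings that the ensemble makes probable. -/
theorem excluded_of_prob_ge (hg : ∀ p y z, z ∈ U p y ↔ ∃ t, g t p y = some z)
    {E : Ensemble} {p x : Str} (hp : E.IsProgram U p) {t n : ℕ} (ha : Answers g t p n)
    (hx : x.length = n) (hpn : p.length < n)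
    (hprob : (2 : ℝ) ^ (3 + p.length) ≤ 2 ^ n * E.prob x) : Excluded g t n x := by
  refine ⟨p, List.mem_flatMap.2 ⟨p.length, List.mem_range.2 hpn, mem_strs.2 rfl⟩, ha, ?_⟩
  obtain ⟨m, hm, happ⟩ := hp.1 x n
  obtain ⟨z, hz⟩ := Option.isSome_iff_exists.1 (ha.1 x (mem_strs.2 hx))
  have hzm : z = m := Part.mem_unique ((hg p _ z).2 ⟨t, hz⟩) hm
  rw [hz, Option.getD_some, hzm]
  -- Rounding loses at most `1`, which the factor `2` between the two thresholds absorbs.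
  have h1 := happ.ge
  have h2 : (1 : ℝ) ≤ 2 ^ (2 + p.length) := one_le_pow₀ one_le_two
  have h3 : (2 : ℝ) ^ (3 + p.length) = 2 * 2 ^ (2 + p.length) := by ring
  have h4 : (2 : ℝ) ^ (2 + p.length) ≤ m := by linarith
  exact_mod_cast h4

/-! ### Estimates for the description length and the probability -/

theorem size_le_logb_add_one {n : ℕ} (hn : 0 < n) : (n.size : ℝ) ≤ Real.logb 2 n + 1 := by
  obtain ⟨k, hk⟩ := Nat.exists_eq_succ_of_ne_zero (Nat.size_pos.2 hn).ne'
  have h1 : 2 ^ k ≤ n := Nat.lt_size.1 (by omega)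
  have h2 : (k : ℝ) ≤ Real.logb 2 n := by
    rw [Real.le_logb_iff_rpow_le one_lt_two (by exact_mod_cast hn), Real.rpow_natCast]
    exact_mod_cast h1
  rw [hk]
  push_cast
  linarith

theorem one_le_logb_two {n : ℕ} (hn : 2 ≤ n) : 1 ≤ Real.logb 2 n := by
  rw [Real.le_logb_iff_rpow_le one_lt_two (by positivity), Real.rpow_one]
  exact_mod_cast hn

theorem length_frame_le {n : ℕ} (hn : 2 ≤ n) (p : Str) :
    ((frame n.bits.length.bits n.bits p).length : ℝ) ≤
      p.length + Real.logb 2 n + 2 * Real.logb 2 (Real.logb 2 n) + 6 := by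
  rw [length_frame, Nat.size_eq_bits_len, Nat.size_eq_bits_len]
  have h1 := size_le_logb_add_one (n := n) (by omega)
  have hpos : 0 < n.size := Nat.size_pos.2 (by omega)
  have h2 := size_le_logb_add_one hpos
  have hl := one_le_logb_two hn
  have h3 : Real.logb 2 (n.size : ℝ) ≤ Real.logb 2 (Real.logb 2 n) + 1 := by
    calc Real.logb 2 (n.size : ℝ) ≤ Real.logb 2 (Real.logb 2 n * 2) :=
          Real.logb_le_logb_of_le one_lt_two (by exact_mod_cast hpos) (by linarith)
      _ = _ := by
          rw [Real.logb_mul (by positivity) two_ne_zero, Real.logb_self_eq_one one_lt_two]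
  push_cast
  linarith

/-- If the complexity of `x` is small, then the ensembles of small complexity that meet the
constraints give `x` a large probability. -/
theorem prob_ge_of_mem_minDomain {δ Δ : ℝ} (hδ : 0 ≤ δ) {x : Str} {N k n : ℕ}
    (hN : K U x ≤ N) {E : Ensemble} (hE : E ∈ minDomain U δ Δ x) (hk : E.K U = k)
    (hle : N + Δ ≤ (1 - δ) * n - 3) : (2 : ℝ) ^ (3 + k) ≤ 2 ^ n * E.prob x := by
  obtain ⟨htyp, hinfo⟩ := hE
  have hH : (k : ℝ) + E.H ≤ N + Δ := by
    have h1 : ((K U x : ℝ≥0∞) : EReal) ≤ (((N : ℕ∞) : ℝ≥0∞) : EReal) :=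
      EReal.coe_ennreal_le_coe_ennreal_iff.2 (ENat.toENNReal_mono hN)
    have h2 := hinfo.trans (add_le_add_left h1 (Δ : EReal))
    simp only [Ensemble.totalInfo, hk, ENat.toENNReal_coe, coe_ennreal_natCast] at h2
    have h3 : (((k : ℝ) + E.H : ℝ) : EReal) ≤ ((N + Δ : ℝ) : EReal) := by
      rwa [EReal.coe_add, EReal.coe_add]
    exact EReal.coe_le_coe_iff.1 h3
  have h4 : E.H * (1 + δ) ≤ n - 3 - k := by
    have h5 : E.H ≤ (1 - δ) * n - 3 - k := by linarith
    -- The loss `(1 - δ) n` pays for the factor `1 + δ` of typicality, since `(1 - δ)(1 + δ) ≤ 1`.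
    have h6 := mul_le_mul_of_nonneg_right h5 (by linarith : 0 ≤ 1 + δ)
    have h7 : 0 ≤ δ * δ * n := by positivity
    have h8 : 0 ≤ δ * k := by positivity
    linarith
  calc (2 : ℝ) ^ (3 + k) = 2 ^ n * 2 ^ (-((n : ℝ) - 3 - k)) := by
        rw [← Real.rpow_natCast, ← Real.rpow_natCast, ← Real.rpow_add two_pos]
        congr 1
        push_cast
        ring
    _ ≤ 2 ^ n * 2 ^ (-(E.H * (1 + δ))) := by gcongr; norm_num
    _ ≤ 2 ^ n * E.prob x := by gcongr; exact htyp

/-! ### The busy-beaver choice -/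

theorem exists_effectively_complex (hU : IsUniversalPrefixComputer U) :
    ∃ ω : ℕ, ∀ δ Δ : ℝ, 0 ≤ δ → 0 ≤ Δ → ∀ n : ℕ, 2 ≤ n → ∃ x : Str, x.length = n ∧
      IsLowerBound U δ Δ x ((1 - δ) * n - (1 + 2 * δ) * Real.logb 2 n
        - 2 * Real.logb 2 (Real.logb 2 (n : ℝ)) - Δ * (4 + δ) - ω) := by
  classical
  obtain ⟨g, hprim, hmono, hg⟩ := hU.toIsPrefixComputer.exists_stages
  have hpf : ∀ t t' y p q, (g t p y).isSome → (g t' q y).isSome → p <+: q → p = q := by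
    intro t t' y p q hp hq
    obtain ⟨z, hz⟩ := Option.isSome_iff_exists.1 hp
    obtain ⟨z', hz'⟩ := Option.isSome_iff_exists.1 hq
    exact hU.prefix_free y p q (Part.dom_iff_mem.2 ⟨z, (hg _ _ _).2 ⟨t, hz⟩⟩)
      (Part.dom_iff_mem.2 ⟨z', (hg _ _ _).2 ⟨t', hz'⟩⟩)
  obtain ⟨c, hc⟩ := hU.universal _ (isPrefixComputer_avoider hprim hpf)
  -- Simulation costs `c`, framing costs `6`, and the exclusion threshold costs `3`.
  refine ⟨c + 9, fun δ Δ hδ hΔ n hn => ?_⟩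
  have hl := one_le_logb_two hn
  have hll : 0 ≤ Real.logb 2 (Real.logb 2 (n : ℝ)) := Real.logb_nonneg one_lt_two hl
  set b : ℝ := (1 - δ) * n - (1 + 2 * δ) * Real.logb 2 n
        - 2 * Real.logb 2 (Real.logb 2 (n : ℝ)) - Δ * (4 + δ) - (c + 9 : ℕ) with hb
  have hδl : 0 ≤ δ * Real.logb 2 n := by positivity
  have hΔδ : 0 ≤ Δ * δ := by positivity
  have hδn : 0 ≤ δ * n := by positivity
  have hbn : b ≤ n := by rw [hb]; push_cast; linarith
  have hfin : {p : Str | (p.length : ℝ) < b ∧ ∃ t, Answers g t p n}.Finite := by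
    refine (List.finite_length_lt Bool n).subset fun p hp => ?_
    exact_mod_cast hp.1.trans_le hbn
  by_cases hne : {p : Str | (p.length : ℝ) < b ∧ ∃ t, Answers g t p n}.Nonempty
  -- `τ p` is the first stage at which `p` has answered; the default `0` is irrelevant on the set
  -- considered.
  · let τ : Str → ℕ := fun p => if h : ∃ t, Answers g t p n then Nat.find h else 0
    obtain ⟨p, ⟨hpb, hpt⟩, hmax⟩ := Set.exists_max_image _ τ hfin hne
    obtain ⟨t, x, ha, hx, hex, hmem⟩ := exists_mem_avoider hpf hpt.choose_spec 0
    obtain ⟨q, hq, hUq⟩ := hc (frame n.bits.length.bits n.bits p)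
    have hKx : K U x ≤ ((frame n.bits.length.bits n.bits p).length + c : ℕ) :=
      (iInf₂_le q (hUq 0 _ hmem)).trans (by exact_mod_cast hq)
    refine ⟨x, hx, isLowerBound_of_forall fun E hE k hk => ?_⟩
    by_contra! hkb
    obtain ⟨r, hr, rfl⟩ := exists_length_eq_of_iInf_eq hk
    have hrt := exists_answers (g := g) hmono hg hr n
    -- The stage `t` found by the search need not be `τ p`, but it cannot be earlier, and `τ p` is
    -- maximal.
    have hτr : τ r ≤ t := by
      refine (hmax r ⟨hkb, hrt⟩).trans ?_
      simp only [τ, dif_pos hpt]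
      exact Nat.find_min' hpt ha
    have har : Answers g t r n := by
      refine Answers.mono (g := g) hmono hτr ?_
      simp only [τ, dif_pos hrt]
      exact Nat.find_spec hrt
    refine hex (excluded_of_prob_ge hg hr har hx (by exact_mod_cast hkb.trans_le hbn) ?_)
    refine prob_ge_of_mem_minDomain hδ hKx hE hk ?_
    have hf := length_frame_le hn p
    rw [hb] at hpb
    push_cast at hpb ⊢
    linarith
  -- If no program shorter than `b` answers, no ensemble has complexity below `b`, and any string
  -- will do.
  · refine ⟨List.replicate n false, by simp, isLowerBound_of_forall fun E _ k hk => ?_⟩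
    by_contra! hkb
    obtain ⟨r, hr, rfl⟩ := exists_length_eq_of_iInf_eq hk
    exact hne ⟨r, hkb, exists_answers (g := g) hmono hg hr n⟩

theorem tendsto_logb_logb_atTop :
    Filter.Tendsto (fun n : ℕ => Real.logb 2 (Real.logb 2 (n : ℝ))) Filter.atTop Filter.atTop :=
  (Real.tendsto_logb_atTop one_lt_two).comp
    ((Real.tendsto_logb_atTop one_lt_two).comp tendsto_natCast_atTop_atTop)

end EffectiveComplexity

theorem mainTheorem3 (U : EffectiveComplexity.Str → ℕ →. ℕ)
    (hU : EffectiveComplexity.IsUniversalPrefixComputer U) :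
    -- the asymptotic bound, for fixed parameters
    (∀ δ Δ : ℝ, 0 ≤ δ → 0 ≤ Δ →
      ∃ f : ℕ → ℝ, f =O[Filter.atTop] (fun n : ℕ => Real.logb 2 (Real.logb 2 (n : ℝ))) ∧
        ∀ n : ℕ, ∃ x : EffectiveComplexity.Str, x.length = n ∧
          EffectiveComplexity.IsLowerBound U δ Δ x
            ((1 - δ) * n - (1 + 2 * δ) * Real.logb 2 n - f n)) ∧
    -- the explicit bound, uniform in all parameters
    (∃ ω : ℕ, ∀ (δ Δ : ℝ) (kδ : ℕ), 0 ≤ δ → 0 ≤ Δ → EffectiveComplexity.KReal U δ = kδ →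
      ∀ n : ℕ, 2 ≤ n → ∃ x : EffectiveComplexity.Str, x.length = n ∧
        EffectiveComplexity.IsLowerBound U δ Δ x
          ((1 - δ) * n - (1 + 2 * δ) * Real.logb 2 n
            - 2 * Real.logb 2 (Real.logb 2 (n : ℝ))
            - Δ * (4 + δ) - 5 * kδ - ω)) := by
  obtain ⟨ω, hω⟩ := EffectiveComplexity.exists_effectively_complex hU
  have hmono : ∀ {δ Δ b b' : ℝ} {x : EffectiveComplexity.Str}, b' ≤ b →
      EffectiveComplexity.IsLowerBound U δ Δ x b → EffectiveComplexity.IsLowerBound U δ Δ x b' :=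
    fun h hb => ⟨(EReal.coe_le_coe h).trans hb.1, fun C => (EReal.coe_le_coe h).trans (hb.2 C)⟩
  constructor
  · intro δ Δ hδ hΔ
    -- The summand `1` makes the bound nonpositive for `n ≤ 1`, where the logarithms take the value
    -- `0`.
    refine ⟨fun n => 2 * Real.logb 2 (Real.logb 2 (n : ℝ)) + (Δ * (4 + δ) + ω + 1), ?_, ?_⟩
    · refine ((Asymptotics.isBigO_refl _ _).const_mul_left 2).add ?_
      exact (Asymptotics.isLittleO_const_left.2 (Or.inr (tendsto_norm_atTop_atTop.comp
        EffectiveComplexity.tendsto_logb_logb_atTop))).isBigO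
    · intro n
      rcases Nat.lt_or_ge n 2 with hn | hn
      · refine ⟨List.replicate n false, by simp,
          EffectiveComplexity.isLowerBound_of_forall fun E _ k _ => ?_⟩
        have h1 : 0 ≤ Δ * (4 + δ) := by positivity
        have h2 : (0 : ℝ) ≤ ω := by positivity
        have h3 : (0 : ℝ) ≤ k := by positivity
        interval_cases n <;> simp <;> linarith
      · obtain ⟨x, hx, hb⟩ := hω δ Δ hδ hΔ n hn
        exact ⟨x, hx, hmono (by linarith) hb⟩
  · refine ⟨ω, fun δ Δ kδ hδ hΔ _ n hn => ?_⟩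
    obtain ⟨x, hx, hb⟩ := hω δ Δ hδ hΔ n hn
    have hk : (0 : ℝ) ≤ kδ := by positivity
    exact ⟨x, hx, hmono (by linarith) hb⟩
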